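/- Conventions. For a smooth map $\phi:(M,g)\to(N,h)$ between Riemannian manifolds (smooth, without boundary), the tension field is $\tau(\phi)=\operatorname{trace}_g\nabla d\phi$ and the bitension field is $$\tau_2(\phi)=-J(\tau(\phi)),\qquad J=\Delta^\phi+\operatorname{trace}_g R^N(d\phi,\cdot)\,d\phi,\qquad \Delta^\phi=-\operatorname{trace}_g(\nabla^\phi)^2,$$ where $\nabla^\phi$ is the pull-back on $\phi^{-1}TN$ of the Levi-Civita connection of $h$, and $R^N(X,Y)=[\nabla^N_X,\nabla^N_Y]-\nabla^N_{[X,Y]}$. The map $\phi$ is biharmonic if $\tau_2(\phi)=0$ on all of $M$. Proposition. Let $(N,h)$ be a Riemannian manifold of dimension $n$, let $\rho\in C^\infty(N)$ and $\widetilde h=e^{2\rho}h$. Let $\mathbf 1:(N,h)\to(N,\widetilde h)$ and $\widetilde{\mathbf 1}:(N,\widetilde h)\to(N,h)$ be the identity maps, and let $\operatorname{grad}$ and $|\cdot|$ be taken with respect to $h$. Then $$\tau_2(\widetilde{\mathbf 1})+e^{-4\rho}\,\tau_2(\mathbf 1)=e^{-4\rho}(n-2)(n-6)\big\{\operatorname{grad}(|\operatorname{grad}\rho|^2)-|\operatorname{grad}\rho|^2\operatorname{grad}\rho\big\}$$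 at every point of $N$. Consequently, if $n=6$, or if $\operatorname{grad}(|\operatorname{grad}\rho|^2)=|\operatorname{grad}\rho|^2\operatorname{grad}\rho$ on $N$, then $\mathbf 1:(N,h)\to(N,\widetilde h)$ is biharmonic if and only if $\widetilde{\mathbf 1}:(N,\widetilde h)\to(N,h)$ is biharmonic. -/

import Mathlib

open Bundle
open scoped Manifold ContDiff

noncomputable section

namespace RiemGeom

/-! ### Local formulas on an open subset of `ℝⁿ`

A metric in coordinates is a function `G` sending a point `u` to a bilinear form on `ℝⁿ`. -/

section Local

variable {n : ℕ} {V : Type*} [AddCommGroup V] [Module ℝ V]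

/-- The `i`-th coordinate vector of `ℝⁿ`. -/
def basisVec (i : Fin n) : EuclideanSpace ℝ (Fin n) := EuclideanSpace.single i 1

/-- The matrix `(g_ij)` of a bilinear form on `ℝⁿ`. -/
def gram (B : EuclideanSpace ℝ (Fin n) →L[ℝ] EuclideanSpace ℝ (Fin n) →L[ℝ] ℝ) :
    Matrix (Fin n) (Fin n) ℝ :=
  Matrix.of fun i j => B (basisVec i) (basisVec j)

/-- The trace `∑ g^{ij} T(e_i, e_j)` of a bilinear map `T` with respect to a bilinear form, where
`(g^{ij})` is the inverse of `(g_ij)`. -/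
def metricTrace (B : EuclideanSpace ℝ (Fin n) →L[ℝ] EuclideanSpace ℝ (Fin n) →L[ℝ] ℝ)
    (T : EuclideanSpace ℝ (Fin n) → EuclideanSpace ℝ (Fin n) → V) : V :=
  ∑ i, ∑ j, (gram B)⁻¹ i j • T (basisVec i) (basisVec j)

/-- The Christoffel symbols of the metric `G` at `u`, as a bilinear map on `ℝⁿ`:
`Γ(X, Y)^k = ∑_l g^{kl} (∂_X g(Y, e_l) + ∂_Y g(X, e_l) - ∂_l g(X, Y)) / 2`.
The Levi-Civita connection of `G` is `∇_X Y = ∂_X Y + Γ(X, Y)`. -/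
def christoffel (G : EuclideanSpace ℝ (Fin n) →
      EuclideanSpace ℝ (Fin n) →L[ℝ] EuclideanSpace ℝ (Fin n) →L[ℝ] ℝ)
    (u X Y : EuclideanSpace ℝ (Fin n)) : EuclideanSpace ℝ (Fin n) :=
  ∑ k, ∑ l, ((gram (G u))⁻¹ k l * ((fderiv ℝ G u X Y (basisVec l)
    + fderiv ℝ G u Y X (basisVec l) - fderiv ℝ G u (basisVec l) X Y) / 2)) • basisVec k

/-- The curvature `R(X, Y) Z = ∇_X ∇_Y Z - ∇_Y ∇_X Z - ∇_[X,Y] Z` of the Levi-Civita connection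
of `G` at `u`; here `X, Y, Z` are constant in the coordinates. -/
def curvature (G : EuclideanSpace ℝ (Fin n) →
      EuclideanSpace ℝ (Fin n) →L[ℝ] EuclideanSpace ℝ (Fin n) →L[ℝ] ℝ)
    (u X Y Z : EuclideanSpace ℝ (Fin n)) : EuclideanSpace ℝ (Fin n) :=
  fderiv ℝ (fun w => christoffel G w Y Z) u X - fderiv ℝ (fun w => christoffel G w X Z) u Y
    + christoffel G u X (christoffel G u Y Z) - christoffel G u Y (christoffel G u X Z)

end Local

section PullbackLocal

variable {m n : ℕ}

/-- The covariant derivative `∇^f_X v = ∂_X v + Γ(df X, v)` at `w` of a vector field `v` along a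
map `f` from an open set of `ℝᵐ` to an open set of `ℝⁿ` with metric `G`. -/
def covDerivAlong (G : EuclideanSpace ℝ (Fin n) →
      EuclideanSpace ℝ (Fin n) →L[ℝ] EuclideanSpace ℝ (Fin n) →L[ℝ] ℝ)
    (f v : EuclideanSpace ℝ (Fin m) → EuclideanSpace ℝ (Fin n))
    (X w : EuclideanSpace ℝ (Fin m)) : EuclideanSpace ℝ (Fin n) :=
  fderiv ℝ v w X + christoffel G (f w) (fderiv ℝ f w X) (v w)

/-- The second covariant derivative `∇^f_X ∇^f_Y v - ∇^f_{∇_X Y} v` of a vector field `v` along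
`f`, where the domain carries the metric `G₁` and the codomain the metric `G₂`; here `X, Y` are
constant in the coordinates. -/
def covHessianAlong (G₁ : EuclideanSpace ℝ (Fin m) →
      EuclideanSpace ℝ (Fin m) →L[ℝ] EuclideanSpace ℝ (Fin m) →L[ℝ] ℝ)
    (G₂ : EuclideanSpace ℝ (Fin n) →
      EuclideanSpace ℝ (Fin n) →L[ℝ] EuclideanSpace ℝ (Fin n) →L[ℝ] ℝ)
    (f v : EuclideanSpace ℝ (Fin m) → EuclideanSpace ℝ (Fin n))
    (u X Y : EuclideanSpace ℝ (Fin m)) : EuclideanSpace ℝ (Fin n) :=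
  covDerivAlong G₂ f (fun w => covDerivAlong G₂ f v Y w) X u
    - covDerivAlong G₂ f v (christoffel G₁ u X Y) u

/-- The second fundamental form `(∇df)(X, Y) = ∇^f_X (df Y) - df (∇_X Y)` of a map `f` at `u`;
here `X, Y` are constant in the coordinates. -/
def secondFundForm (G₁ : EuclideanSpace ℝ (Fin m) →
      EuclideanSpace ℝ (Fin m) →L[ℝ] EuclideanSpace ℝ (Fin m) →L[ℝ] ℝ)
    (G₂ : EuclideanSpace ℝ (Fin n) →
      EuclideanSpace ℝ (Fin n) →L[ℝ] EuclideanSpace ℝ (Fin n) →L[ℝ] ℝ)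
    (f : EuclideanSpace ℝ (Fin m) → EuclideanSpace ℝ (Fin n))
    (u X Y : EuclideanSpace ℝ (Fin m)) : EuclideanSpace ℝ (Fin n) :=
  covDerivAlong G₂ f (fun w => fderiv ℝ f w Y) X u - fderiv ℝ f u (christoffel G₁ u X Y)

end PullbackLocal

/-! ### Riemannian manifolds -/

section Manifold

variable {n : ℕ} {N : Type*} [TopologicalSpace N] [ChartedSpace (EuclideanSpace ℝ (Fin n)) N]
  [IsManifold (𝓡 n) ∞ N]

variable (n N) in
/-- A smooth Riemannian metric on the `n`-dimensional manifold `N` (without boundary). -/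
abbrev RiemMetric : Type _ :=
  ContMDiffRiemannianMetric (𝓡 n) ∞ (EuclideanSpace ℝ (Fin n)) (TangentSpace (𝓡 n) : N → Type _)

/-- The components of a tangent vector at `p` in the chart at `x` (meaningful when `p` lies in the
domain of that chart, where this is the derivative of the chart). -/
def toCoord (x p : N) : TangentSpace (𝓡 n) p →L[ℝ] EuclideanSpace ℝ (Fin n) :=
  (trivializationAt (EuclideanSpace ℝ (Fin n)) (TangentSpace (𝓡 n)) x).continuousLinearMapAt ℝ p

/-- The tangent vector at `p` with given components in the chart at `x`. -/
def ofCoord (x p : N) : EuclideanSpace ℝ (Fin n) →L[ℝ] TangentSpace (𝓡 n) p :=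
  (trivializationAt (EuclideanSpace ℝ (Fin n)) (TangentSpace (𝓡 n)) x).symmL ℝ p

/-- The metric `h` in the chart at `x`. -/
def localMetric (h : RiemMetric n N) (x : N) (u : EuclideanSpace ℝ (Fin n)) :
    EuclideanSpace ℝ (Fin n) →L[ℝ] EuclideanSpace ℝ (Fin n) →L[ℝ] ℝ :=
  (ContinuousLinearMap.precomp ℝ (ofCoord x ((extChartAt (𝓡 n) x).symm u))) ∘L
    (h.inner ((extChartAt (𝓡 n) x).symm u)) ∘L (ofCoord x ((extChartAt (𝓡 n) x).symm u))

theorem localMetric_apply (h : RiemMetric n N) (x : N) (u X Y : EuclideanSpace ℝ (Fin n)) :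
    localMetric h x u X Y = h.inner ((extChartAt (𝓡 n) x).symm u)
      (ofCoord x ((extChartAt (𝓡 n) x).symm u) X) (ofCoord x ((extChartAt (𝓡 n) x).symm u) Y) :=
  rfl

/-- The inner product given by `h` on the tangent space at `x`, as a bilinear form. -/
def bilin (h : RiemMetric n N) (x : N) : LinearMap.BilinForm ℝ (TangentSpace (𝓡 n) x) :=
  (h.inner x).toLinearMap₁₂

theorem bilin_nondegenerate (h : RiemMetric n N) (x : N) : (bilin h x).Nondegenerate := by
  have key : ∀ v, bilin h x v v = 0 → v = 0 := by
    intro v hv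
    by_contra hne
    exact (h.pos x v hne).ne' hv
  exact ⟨fun v hv => key v (hv v), fun v hv => key v (hv v)⟩

/-- The gradient of `f` with respect to `h`: `h(grad f, v) = df(v)` for all tangent vectors `v`. -/
def grad (h : RiemMetric n N) (f : N → ℝ) (x : N) : TangentSpace (𝓡 n) x :=
  haveI : FiniteDimensional ℝ (TangentSpace (𝓡 n) x) :=
    inferInstanceAs (FiniteDimensional ℝ (EuclideanSpace ℝ (Fin n)))
  ((bilin h x).toDual (bilin_nondegenerate h x)).symm
    (mfderiv (𝓡 n) 𝓘(ℝ, ℝ) f x).toLinearMap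

theorem inner_grad (h : RiemMetric n N) (f : N → ℝ) (x : N) (v : TangentSpace (𝓡 n) x) :
    h.inner x (grad h f x) v = mfderiv (𝓡 n) 𝓘(ℝ, ℝ) f x v := by
  have : FiniteDimensional ℝ (TangentSpace (𝓡 n) x) :=
    inferInstanceAs (FiniteDimensional ℝ (EuclideanSpace ℝ (Fin n)))
  exact LinearMap.BilinForm.apply_toDual_symm_apply (hB := bilin_nondegenerate h x) _ _

/-- The squared length `|grad f|²` with respect to `h`. -/
def gradNormSq (h : RiemMetric n N) (f : N → ℝ) (x : N) : ℝ :=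
  h.inner x (grad h f x) (grad h f x)

set_option synthInstance.maxHeartbeats 400000 in
set_option maxHeartbeats 1000000 in
theorem contMDiff_smul_metric (h : RiemMetric n N) {f : N → ℝ}
    (hf : ContMDiff (𝓡 n) 𝓘(ℝ, ℝ) ∞ f) :
    ContMDiff (𝓡 n) ((𝓡 n).prod
        𝓘(ℝ, EuclideanSpace ℝ (Fin n) →L[ℝ] EuclideanSpace ℝ (Fin n) →L[ℝ] ℝ)) ∞
      (fun x => TotalSpace.mk' (EuclideanSpace ℝ (Fin n) →L[ℝ] EuclideanSpace ℝ (Fin n) →L[ℝ] ℝ) x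
        (f x • h.inner x)) := by
  intro x
  have h1 := h.contMDiff x
  rw [contMDiffAt_section] at h1 ⊢
  exact ((hf x).smul h1).congr_of_eventuallyEq (Filter.Eventually.of_forall fun y => by
    ext v w
    simp [hom_trivializationAt_apply, ContinuousLinearMap.inCoordinates])

/-- The conformally equivalent metric `e^{2ρ} h`. -/
def conformal (h : RiemMetric n N) (ρ : N → ℝ) (hρ : ContMDiff (𝓡 n) 𝓘(ℝ, ℝ) ∞ ρ) :
    RiemMetric n N where
  inner x := Real.exp (2 * ρ x) • h.inner x
  symm x v w := by simp [h.symm x v w]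
  pos x v hv := by
    simpa using mul_pos (Real.exp_pos (2 * ρ x)) (h.pos x v hv)
  isVonNBounded x := by
    have hb := (h.isVonNBounded x).image
      (Real.exp (-ρ x) • ContinuousLinearMap.id ℝ (TangentSpace (𝓡 n) x))
    refine hb.subset fun v hv => (Set.mem_image _ _ _).2 ⟨Real.exp (ρ x) • v, ?_, ?_⟩
    · have hv' : Real.exp (2 * ρ x) * h.inner x v v < 1 := hv
      have he : Real.exp (2 * ρ x) = Real.exp (ρ x) * Real.exp (ρ x) := by
        rw [← Real.exp_add]; ring_nf
      simp only [Set.mem_ofPred_eq, map_smul, FunLike.coe_smul, Pi.smul_apply, smul_eq_mul]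
      rw [he] at hv'
      linarith
    · simp [smul_smul, ← Real.exp_add]
  contMDiff := by
    have he : ContMDiff (𝓡 n) 𝓘(ℝ, ℝ) ∞ fun x => Real.exp (2 * ρ x) :=
      (Real.contDiff_exp.comp (contDiff_const.mul contDiff_id)).contMDiff.comp hρ
    exact contMDiff_smul_metric h he

end Manifold

section Maps

variable {m n : ℕ}
  {M : Type*} [TopologicalSpace M] [ChartedSpace (EuclideanSpace ℝ (Fin m)) M]
  [IsManifold (𝓡 m) ∞ M]
  {N : Type*} [TopologicalSpace N] [ChartedSpace (EuclideanSpace ℝ (Fin n)) N]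
  [IsManifold (𝓡 n) ∞ N]

/-- A vector field `V` along `φ : M → N` in the charts at `x` and `φ x`. -/
def localSection (φ : M → N) (V : ∀ p, TangentSpace (𝓡 n) (φ p)) (x : M)
    (u : EuclideanSpace ℝ (Fin m)) : EuclideanSpace ℝ (Fin n) :=
  toCoord (φ x) (φ ((extChartAt (𝓡 m) x).symm u)) (V ((extChartAt (𝓡 m) x).symm u))

/-- The tension field `τ(φ) = trace_g ∇dφ` of `φ : (M, g) → (N, h)`, computed at `x` in the charts
at `x` and `φ x`. -/
def tension (g : RiemMetric m M) (h : RiemMetric n N) (φ : M → N) (x : M) :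
    TangentSpace (𝓡 n) (φ x) :=
  ofCoord (φ x) (φ x)
    (metricTrace (localMetric g x (extChartAt (𝓡 m) x x))
      (secondFundForm (localMetric g x) (localMetric h (φ x))
        (writtenInExtChartAt (𝓡 m) (𝓡 n) x φ) (extChartAt (𝓡 m) x x)))

/-- The Laplacian `Δ^φ V = - trace_g (∇^φ)² V` of a vector field `V` along `φ`. -/
def laplacianAlong (g : RiemMetric m M) (h : RiemMetric n N) (φ : M → N)
    (V : ∀ p, TangentSpace (𝓡 n) (φ p)) (x : M) : TangentSpace (𝓡 n) (φ x) :=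
  - ofCoord (φ x) (φ x)
    (metricTrace (localMetric g x (extChartAt (𝓡 m) x x))
      (covHessianAlong (localMetric g x) (localMetric h (φ x))
        (writtenInExtChartAt (𝓡 m) (𝓡 n) x φ) (localSection φ V x) (extChartAt (𝓡 m) x x)))

/-- The term `trace_g R^N(dφ ·, V) dφ ·` for a vector field `V` along `φ`. -/
def curvatureTrace (g : RiemMetric m M) (h : RiemMetric n N) (φ : M → N)
    (V : ∀ p, TangentSpace (𝓡 n) (φ p)) (x : M) : TangentSpace (𝓡 n) (φ x) :=
  ofCoord (φ x) (φ x)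
    (metricTrace (localMetric g x (extChartAt (𝓡 m) x x))
      fun X Y => curvature (localMetric h (φ x)) (extChartAt (𝓡 n) (φ x) (φ x))
        (fderiv ℝ (writtenInExtChartAt (𝓡 m) (𝓡 n) x φ) (extChartAt (𝓡 m) x x) X)
        (localSection φ V x (extChartAt (𝓡 m) x x))
        (fderiv ℝ (writtenInExtChartAt (𝓡 m) (𝓡 n) x φ) (extChartAt (𝓡 m) x x) Y))

/-- The Jacobi operator `J = Δ^φ + trace_g R^N(dφ ·, ·) dφ ·`. -/
def jacobi (g : RiemMetric m M) (h : RiemMetric n N) (φ : M → N)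
    (V : ∀ p, TangentSpace (𝓡 n) (φ p)) (x : M) : TangentSpace (𝓡 n) (φ x) :=
  laplacianAlong g h φ V x + curvatureTrace g h φ V x

/-- The bitension field `τ₂(φ) = - J(τ(φ))` of `φ : (M, g) → (N, h)`. -/
def bitension (g : RiemMetric m M) (h : RiemMetric n N) (φ : M → N) (x : M) :
    TangentSpace (𝓡 n) (φ x) :=
  - jacobi g h φ (tension g h φ) x

/-- A smooth map `φ : (M, g) → (N, h)` is biharmonic if its bitension field vanishes. -/
def IsBiharmonic (g : RiemMetric m M) (h : RiemMetric n N) (φ : M → N) : Prop :=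
  ContMDiff (𝓡 m) (𝓡 n) ∞ φ ∧ ∀ x, bitension g h φ x = 0

end Maps

end RiemGeom

end

noncomputable section

namespace RiemGeom


/-! In a chart the identity map reads as the identity of an open set of `ℝⁿ` carrying two metrics, G
and e^{2r}G. Write W for the gradient of r and |W|² = dr(W), both with respect to G, and Q for the
gradient of |W|². Everything rests on `christoffel_conf`: the two connections differ by the tensor
dr(X)Y + dr(Y)X - G(X,Y)W. Its G-trace is (2-n)W, so the two tension fields are (2-n)W and
(n-2)e^{-2r}W.

The bitension field is the trace of the second covariant derivative of the tension field minus a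
curvature trace, and it is linear over constants in that field. It therefore suffices to treat W and
e^{-2r}W. Expanding with the difference tensor (`covHessian_conf`, `covHessian_smul`,
`curvature_conf`) and tracing, with ∇_W W = Q/2 and B the same expression for W built from G alone,
gives B + (6-n)/2 Q + (2-n)|W|²W - 2 div(W) W for the identity into e^{2r}G, and e^{-4r}(B + (n-6)/2
Q + (8-2n)|W|²W - 2 div(W) W) for the identity out of it. The prefactors 2-n and n-2 are opposite,
so in the weighted sum B, which holds all second derivatives of W and the curvature, cancels
together with the divergence. What survives is (n-2)(n-6)(Q - |W|²W), times e^{-4r}. The last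
section carries this back to the manifold. -/

/-- The coordinate space `ℝⁿ`. -/
abbrev Coord (n : ℕ) : Type := EuclideanSpace ℝ (Fin n)

/-- Bilinear forms on `ℝⁿ`. -/
abbrev Form (n : ℕ) : Type := Coord n →L[ℝ] Coord n →L[ℝ] ℝ

/-- A bilinear form is an inner product if it is symmetric and positive definite. -/
structure IsInner {n : ℕ} (B : Form n) : Prop where
  symm : ∀ X Y, B X Y = B Y X
  pos : ∀ X, X ≠ 0 → 0 < B X X

/-! ### Linear algebra of an inner product: Gram matrix, duals and traces. -/

section Algebra

variable {n : ℕ} {B : Form n}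

theorem sum_basisVec (Y : Coord n) : ∑ j, Y j • basisVec j = Y := by
  ext k
  simp [basisVec, Pi.single_apply]

theorem IsInner.ext (hB : IsInner B) {v w : Coord n} (h : ∀ Y, B v Y = B w Y) : v = w := by
  by_contra hne
  have h0 : B (v - w) (v - w) = 0 := by rw [map_sub B, _root_.sub_apply, h, sub_self]
  exact (hB.pos (v - w) (sub_ne_zero.2 hne)).ne' h0

theorem IsInner.smul (hB : IsInner B) {c : ℝ} (hc : 0 < c) : IsInner (c • B) where
  symm X Y := by simp [hB.symm X Y]
  pos X hX := by simpa using mul_pos hc (hB.pos X hX)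

theorem gram_mulVec (B : Form n) (v : Fin n → ℝ) (i : Fin n) :
    (gram B).mulVec v i = B (basisVec i) (∑ j, v j • basisVec j) := by
  simp [Matrix.mulVec, dotProduct, gram, mul_comm]

theorem eq_of_basisVec {α β : Coord n →L[ℝ] ℝ} (h : ∀ i, α (basisVec i) = β (basisVec i)) :
    α = β := by
  ext Y
  rw [← sum_basisVec Y, map_sum, map_sum]
  exact Finset.sum_congr rfl fun i _ => by rw [map_smul, map_smul, h]

/-- A vector in the kernel of the Gram matrix pairs to zero with every basis vector, hence vanishes
by definiteness. -/
theorem IsInner.isUnit_gram (hB : IsInner B) : IsUnit (gram B) := by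
  rw [← Matrix.mulVec_injective_iff_isUnit]
  intro v w h
  have h' : ∑ j, v j • basisVec j = ∑ j, w j • basisVec j := by
    refine hB.ext fun Y => ?_
    refine congrArg (fun α : Coord n →L[ℝ] ℝ => α Y) (eq_of_basisVec fun i => ?_)
    rw [hB.symm, hB.symm _ (basisVec i), ← gram_mulVec, ← gram_mulVec, h]
  funext k
  have := congrArg (fun z : Coord n => z k) h'
  simpa [basisVec, Pi.single_apply] using this

theorem IsInner.gram_transpose (hB : IsInner B) : (gram B).transpose = gram B := by
  ext i j
  exact hB.symm _ _

theorem IsInner.gram_mul_inv (hB : IsInner B) : gram B * (gram B)⁻¹ = 1 :=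
  Matrix.mul_nonsing_inv _ ((Matrix.isUnit_iff_isUnit_det _).1 hB.isUnit_gram)

theorem IsInner.inv_symm (hB : IsInner B) (i j : Fin n) : (gram B)⁻¹ i j = (gram B)⁻¹ j i := by
  have h := Matrix.transpose_nonsing_inv (gram B)
  rw [hB.gram_transpose] at h
  exact congrFun (congrFun h j) i

/-- The vector dual to a linear form. -/
theorem IsInner.sharp_apply (hB : IsInner B) (α : Coord n →L[ℝ] ℝ) (Y : Coord n) :
    B (∑ k, ∑ l, ((gram B)⁻¹ k l * α (basisVec l)) • basisVec k) Y = α Y := by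
  refine congrArg (fun α : Coord n →L[ℝ] ℝ => α Y) (eq_of_basisVec fun i => ?_)
  have h : (∑ k, ∑ l, ((gram B)⁻¹ k l * α (basisVec l)) • basisVec k : Coord n)
      = ∑ k, ((gram B)⁻¹.mulVec fun l => α (basisVec l)) k • basisVec k := by
    simp [Matrix.mulVec, dotProduct, Finset.sum_smul]
  rw [hB.symm, h, ← gram_mulVec, Matrix.mulVec_mulVec, hB.gram_mul_inv, Matrix.one_mulVec]

theorem IsInner.eq_sharp (hB : IsInner B) {W : Coord n} {α : Coord n →L[ℝ] ℝ}
    (h : ∀ Y, B W Y = α Y) :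
    W = ∑ k, ∑ l, ((gram B)⁻¹ k l * α (basisVec l)) • basisVec k :=
  hB.ext fun Y => by rw [h, hB.sharp_apply]

variable {V : Type*} [AddCommGroup V] [Module ℝ V]

theorem metricTrace_add (B : Form n) (S T : Coord n → Coord n → V) :
    metricTrace B (fun X Y => S X Y + T X Y) = metricTrace B S + metricTrace B T := by
  simp [metricTrace, Finset.sum_add_distrib]

theorem metricTrace_sub (B : Form n) (S T : Coord n → Coord n → V) :
    metricTrace B (fun X Y => S X Y - T X Y) = metricTrace B S - metricTrace B T := by
  simp [metricTrace, smul_sub]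

theorem metricTrace_smul (B : Form n) (c : ℝ) (T : Coord n → Coord n → V) :
    metricTrace B (fun X Y => c • T X Y) = c • metricTrace B T := by
  simp [metricTrace, Finset.smul_sum, smul_comm c]

theorem metricTrace_smul_const (B : Form n) (t : Coord n → Coord n → ℝ) (v : V) :
    metricTrace B (fun X Y => t X Y • v) = metricTrace B t • v := by
  simp [metricTrace, Finset.sum_smul, smul_smul]

theorem IsInner.metricTrace_self (hB : IsInner B) : metricTrace B (fun X Y => B X Y) = n := by
  have h : metricTrace B (fun X Y => B X Y) = ((gram B) * (gram B)⁻¹).trace := by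
    simp only [metricTrace, Matrix.trace, Matrix.diag, Matrix.mul_apply, smul_eq_mul]
    refine Finset.sum_congr rfl fun i _ => Finset.sum_congr rfl fun j _ => ?_
    rw [hB.inv_symm, mul_comm]
    rfl
  rw [h, hB.gram_mul_inv]
  simp

/-- Contracting with the inverse Gram matrix turns the form α back into the vector W it is dual to.
All traces involving dr or d|W|² are evaluated this way. -/
theorem IsInner.metricTrace_right (hB : IsInner B) {W : Coord n} {α : Coord n →L[ℝ] ℝ}
    (h : ∀ Y, B W Y = α Y) (L : Coord n →ₗ[ℝ] V) :
    metricTrace B (fun X Y => α Y • L X) = L W := by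
  conv_rhs => rw [hB.eq_sharp h]
  simp [metricTrace, map_sum, smul_smul]

theorem IsInner.metricTrace_left (hB : IsInner B) {W : Coord n} {α : Coord n →L[ℝ] ℝ}
    (h : ∀ Y, B W Y = α Y) (L : Coord n →ₗ[ℝ] V) :
    metricTrace B (fun X Y => α X • L Y) = L W := by
  rw [← hB.metricTrace_right h L, metricTrace, Finset.sum_comm]
  simp only [metricTrace]
  refine Finset.sum_congr rfl fun i _ => Finset.sum_congr rfl fun j _ => ?_
  rw [hB.inv_symm]

theorem metricTrace_form_smul (B : Form n) {c : ℝ} (hc : c ≠ 0) (T : Coord n → Coord n → V) :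
    metricTrace (c • B) T = c⁻¹ • metricTrace B T := by
  have h1 : gram (c • B) = c • gram B := by
    ext i j
    simp [gram]
  have h2 : (gram (c • B))⁻¹ = c⁻¹ • (gram B)⁻¹ := by
    by_cases hu : IsUnit (gram B).det
    · rw [h1]
      exact Matrix.inv_smul' (gram B) (Units.mk0 c hc) hu
    -- A singular matrix has inverse 0 by convention, and scaling keeps it singular, so no
    -- positivity of `B` is needed.
    · rw [h1, Matrix.nonsing_inv_apply_not_isUnit _ hu, smul_zero,
        Matrix.nonsing_inv_apply_not_isUnit]
      rw [Matrix.det_smul, isUnit_iff_ne_zero]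
      rw [isUnit_iff_ne_zero] at hu
      simpa using fun _ => not_not.1 hu
  simp only [metricTrace, h2, Finset.smul_sum, Matrix.smul_apply, smul_smul, smul_eq_mul]

end Algebra


/-! ### Levi-Civita calculus in coordinates: Christoffel symbols, gradients, Hessians. -/

section Calculus

open Filter Topology

variable {n : ℕ} {G : Coord n → Form n} {r : Coord n → ℝ} {W : Coord n → Coord n} {u : Coord n}

/-- `G` is a smooth Riemannian metric near `u`. -/
def IsMetricAt (G : Coord n → Form n) (u : Coord n) : Prop :=
  ∀ᶠ w in 𝓝 u, ContDiffAt ℝ ∞ G w ∧ IsInner (G w)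

/-- `W` is the gradient of the smooth function `r` with respect to `G` near `u`. -/
def IsGradAt (G : Coord n → Form n) (r : Coord n → ℝ) (W : Coord n → Coord n) (u : Coord n) :
    Prop :=
  ∀ᶠ w in 𝓝 u, ContDiffAt ℝ ∞ r w ∧ ∀ Y, G w (W w) Y = fderiv ℝ r w Y

/-- Being a metric near u passes to all nearby points. An identity proved at one point thus holds on
a neighbourhood and may be differentiated. -/
theorem IsMetricAt.eventually (hG : IsMetricAt G u) : ∀ᶠ w in 𝓝 u, IsMetricAt G w :=
  eventually_eventually_nhds.2 hG

theorem IsMetricAt.contDiffAt (hG : IsMetricAt G u) : ContDiffAt ℝ ∞ G u :=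
  hG.self_of_nhds.1

theorem IsMetricAt.isInner (hG : IsMetricAt G u) : IsInner (G u) :=
  hG.self_of_nhds.2

theorem IsMetricAt.differentiableAt (hG : IsMetricAt G u) : DifferentiableAt ℝ G u :=
  hG.contDiffAt.differentiableAt (by simp)

theorem IsGradAt.eventually (hW : IsGradAt G r W u) : ∀ᶠ w in 𝓝 u, IsGradAt G r W w :=
  eventually_eventually_nhds.2 hW

theorem IsGradAt.contDiffAt (hW : IsGradAt G r W u) : ContDiffAt ℝ ∞ r u :=
  hW.self_of_nhds.1

theorem IsGradAt.inner (hW : IsGradAt G r W u) (Y : Coord n) :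
    G u (W u) Y = fderiv ℝ r u Y :=
  hW.self_of_nhds.2 Y

theorem IsGradAt.differentiableAt (hW : IsGradAt G r W u) : DifferentiableAt ℝ r u :=
  hW.contDiffAt.differentiableAt (by simp)

theorem IsGradAt.contDiffAt_fderiv (hW : IsGradAt G r W u) : ContDiffAt ℝ ∞ (fderiv ℝ r) u :=
  hW.contDiffAt.fderiv_right (by simp)

theorem IsGradAt.differentiableAt_fderiv (hW : IsGradAt G r W u) :
    DifferentiableAt ℝ (fderiv ℝ r) u :=
  hW.contDiffAt_fderiv.differentiableAt (by simp)

theorem contDiffAt_det {m : ℕ} {M : Coord n → Matrix (Fin m) (Fin m) ℝ}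
    (hM : ∀ i j, ContDiffAt ℝ ∞ (fun w => M w i j) u) :
    ContDiffAt ℝ ∞ (fun w => (M w).det) u := by
  simp only [Matrix.det_apply]
  refine ContDiffAt.sum fun σ _ => ContDiffAt.const_smul _ ?_
  exact contDiffAt_prod fun i _ => hM _ _

/-- Cramer's rule: each entry of the inverse is a quotient of determinants of smooth matrices, with
nonzero denominator. -/
theorem IsMetricAt.contDiffAt_inv_gram (hG : IsMetricAt G u) (k l : Fin n) :
    ContDiffAt ℝ ∞ (fun w => (gram (G w))⁻¹ k l) u := by
  have hg : ∀ i j, ContDiffAt ℝ ∞ (fun w => gram (G w) i j) u := fun i j =>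
    (hG.contDiffAt.clm_apply contDiffAt_const).clm_apply contDiffAt_const
  have hdet : (gram (G u)).det ≠ 0 :=
    ((Matrix.isUnit_iff_isUnit_det _).1 hG.isInner.isUnit_gram).ne_zero
  simp only [Matrix.inv_def, Matrix.smul_apply, Ring.inverse_eq_inv', smul_eq_mul,
    Matrix.adjugate_apply]
  refine ((contDiffAt_det hg).inv hdet).mul (contDiffAt_det fun i j => ?_)
  by_cases h : i = l
  · subst h
    simpa using contDiffAt_const
  · simpa [Matrix.updateRow_ne h] using hg i j

theorem contDiffAt_fderiv_apply {E F : Type*} [NormedAddCommGroup E] [NormedSpace ℝ E]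
    [NormedAddCommGroup F] [NormedSpace ℝ F] {f : E → F} {u : E} (hf : ContDiffAt ℝ ∞ f u)
    {X : E → E} (hX : ContDiffAt ℝ ∞ X u) : ContDiffAt ℝ ∞ (fun w => fderiv ℝ f w (X w)) u :=
  (hf.fderiv_right (by simp)).clm_apply hX

theorem IsMetricAt.contDiffAt_christoffel (hG : IsMetricAt G u) {X Y : Coord n → Coord n}
    (hX : ContDiffAt ℝ ∞ X u) (hY : ContDiffAt ℝ ∞ Y u) :
    ContDiffAt ℝ ∞ (fun w => christoffel G w (X w) (Y w)) u := by
  have hd : ∀ {X Y Z : Coord n → Coord n}, ContDiffAt ℝ ∞ X u → ContDiffAt ℝ ∞ Y u →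
      ContDiffAt ℝ ∞ Z u → ContDiffAt ℝ ∞ (fun w => fderiv ℝ G w (X w) (Y w) (Z w)) u :=
    fun hX hY hZ => ((contDiffAt_fderiv_apply hG.contDiffAt hX).clm_apply hY).clm_apply hZ
  unfold christoffel
  refine ContDiffAt.sum fun k _ => ContDiffAt.sum fun l _ => ?_
  refine ContDiffAt.smul ((hG.contDiffAt_inv_gram k l).mul (ContDiffAt.div_const ?_ _))
    contDiffAt_const
  exact ((hd hX hY contDiffAt_const).add (hd hY hX contDiffAt_const)).sub
    (hd contDiffAt_const hX hY)

/-- Smoothness of W is not part of `IsGradAt`; it follows from the explicit formula for W through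
the inverse Gram matrix. -/
theorem IsGradAt.contDiffAt_grad (hG : IsMetricAt G u) (hW : IsGradAt G r W u) :
    ContDiffAt ℝ ∞ W u := by
  have h : W =ᶠ[𝓝 u] fun w =>
      ∑ k, ∑ l, ((gram (G w))⁻¹ k l * fderiv ℝ r w (basisVec l)) • basisVec k := by
    filter_upwards [hG, hW] with w h1 h2
    exact h1.2.eq_sharp h2.2
  refine ContDiffAt.congr_of_eventuallyEq ?_ h
  refine ContDiffAt.sum fun k _ => ContDiffAt.sum fun l _ => ?_
  exact ((hG.contDiffAt_inv_gram k l).mul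
    (hW.contDiffAt_fderiv.clm_apply contDiffAt_const)).smul contDiffAt_const

/-! ### Christoffel symbols -/

/-- Koszul's formula. With `IsInner.ext` it lets identities between Christoffel symbols be checked
without the inverse metric. -/
theorem IsInner.christoffel_inner {w : Coord n} (hw : IsInner (G w)) (X Y Z : Coord n) :
    G w (christoffel G w X Y) Z
      = (fderiv ℝ G w X Y Z + fderiv ℝ G w Y X Z - fderiv ℝ G w Z X Y) / 2 := by
  have h := hw.sharp_apply ((2 : ℝ)⁻¹ • (fderiv ℝ G w X Y + fderiv ℝ G w Y X
    - ((fderiv ℝ G w).flip X).flip Y)) Z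
  simp only [smul_apply, add_apply, sub_apply, ContinuousLinearMap.flip_apply, smul_eq_mul] at h
  rw [div_eq_inv_mul, ← h]
  simp only [christoffel, div_eq_inv_mul]

theorem christoffel_add_right (G : Coord n → Form n) (w X Y Y' : Coord n) :
    christoffel G w X (Y + Y') = christoffel G w X Y + christoffel G w X Y' := by
  simp only [christoffel, map_add, add_apply, ← Finset.sum_add_distrib, ← add_smul]
  refine Finset.sum_congr rfl fun k _ => Finset.sum_congr rfl fun l _ => ?_
  congr 1
  ring

theorem christoffel_smul_right (G : Coord n → Form n) (w X Y : Coord n) (c : ℝ) :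
    christoffel G w X (c • Y) = c • christoffel G w X Y := by
  simp only [christoffel, map_smul, smul_apply, Finset.smul_sum, smul_smul, smul_eq_mul]
  refine Finset.sum_congr rfl fun k _ => Finset.sum_congr rfl fun l _ => ?_
  congr 1
  ring

theorem christoffel_sub_right (G : Coord n → Form n) (w X Y Y' : Coord n) :
    christoffel G w X (Y - Y') = christoffel G w X Y - christoffel G w X Y' := by
  rw [sub_eq_add_neg, ← neg_one_smul ℝ Y', christoffel_add_right, christoffel_smul_right]
  module

theorem fderiv_form_apply (hG : DifferentiableAt ℝ G u) (X Y Z : Coord n) :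
    fderiv ℝ (fun w => G w Y Z) u X = fderiv ℝ G u X Y Z := by
  have h := ((hG.hasFDerivAt.clm_apply (hasFDerivAt_const Y u)).clm_apply
    (hasFDerivAt_const Z u)).fderiv
  rw [h]
  simp

theorem IsMetricAt.fderiv_symm (hG : IsMetricAt G u) (X Y Z : Coord n) :
    fderiv ℝ G u X Y Z = fderiv ℝ G u X Z Y := by
  rw [← fderiv_form_apply hG.differentiableAt, ← fderiv_form_apply hG.differentiableAt]
  have h : (fun w => G w Y Z) =ᶠ[𝓝 u] fun w => G w Z Y := by
    filter_upwards [hG] with w hw using hw.2.symm Y Z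
  rw [h.fderiv_eq]

theorem IsMetricAt.christoffel_symm (hG : IsMetricAt G u) (X Y : Coord n) :
    christoffel G u X Y = christoffel G u Y X := by
  refine hG.isInner.ext fun Z => ?_
  rw [hG.isInner.christoffel_inner, hG.isInner.christoffel_inner, hG.fderiv_symm Z X Y]
  ring

/-- The Levi-Civita connection is compatible with the metric. -/
theorem IsMetricAt.fderiv_eq (hG : IsMetricAt G u) (X Y Z : Coord n) :
    fderiv ℝ G u X Y Z = G u (christoffel G u X Y) Z + G u Y (christoffel G u X Z) := by
  rw [hG.isInner.symm Y, hG.isInner.christoffel_inner, hG.isInner.christoffel_inner,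
    hG.fderiv_symm X Z Y, hG.fderiv_symm Y X Z, hG.fderiv_symm Z X Y]
  ring

/-! ### Covariant derivatives of vector fields -/

/-- The covariant derivative `∇_X V`. -/
def covDeriv (G : Coord n → Form n) (V : Coord n → Coord n) (X w : Coord n) : Coord n :=
  fderiv ℝ V w X + christoffel G w X (V w)

/-- The second covariant derivative of `V`, for the connection of `G₂` on the vector field and
that of `G₁` on the domain. -/
def covHessian (G₁ G₂ : Coord n → Form n) (V : Coord n → Coord n) (u X Y : Coord n) : Coord n :=
  covDeriv G₂ (fun w => covDeriv G₂ V Y w) X u - covDeriv G₂ V (christoffel G₁ u X Y) u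

theorem covDeriv_congr {V V' : Coord n → Coord n} (h : V =ᶠ[𝓝 u] V') (G : Coord n → Form n)
    (X : Coord n) : covDeriv G V X u = covDeriv G V' X u := by
  rw [covDeriv, covDeriv, h.fderiv_eq, h.eq_of_nhds]

theorem covDerivAlong_eq {f V : Coord n → Coord n} (hf : f =ᶠ[𝓝 u] id) (G : Coord n → Form n)
    (X : Coord n) : covDerivAlong G f V X u = covDeriv G V X u := by
  rw [covDerivAlong, covDeriv, hf.fderiv_eq, hf.eq_of_nhds]
  simp

theorem covHessianAlong_eq {f V V' : Coord n → Coord n} (hf : f =ᶠ[𝓝 u] id)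
    (hV : V =ᶠ[𝓝 u] V') (G₁ G₂ : Coord n → Form n) (X Y : Coord n) :
    covHessianAlong G₁ G₂ f V u X Y = covHessian G₁ G₂ V' u X Y := by
  have h : (fun w => covDerivAlong G₂ f V Y w) =ᶠ[𝓝 u] fun w => covDeriv G₂ V' Y w := by
    filter_upwards [hf.eventuallyEq_nhds, hV.eventuallyEq_nhds] with w h1 h2
    rw [covDerivAlong_eq h1, covDeriv_congr h2]
  rw [covHessianAlong, covHessian, covDerivAlong_eq hf, covDerivAlong_eq hf, covDeriv_congr hV,
    covDeriv_congr h]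

theorem secondFundForm_eq {f : Coord n → Coord n} (hf : f =ᶠ[𝓝 u] id) (G₁ G₂ : Coord n → Form n)
    (X Y : Coord n) :
    secondFundForm G₁ G₂ f u X Y = christoffel G₂ u X Y - christoffel G₁ u X Y := by
  have h : (fun w => fderiv ℝ f w Y) =ᶠ[𝓝 u] fun _ => Y := by
    filter_upwards [hf.eventuallyEq_nhds] with w h1
    rw [h1.fderiv_eq]
    simp
  rw [secondFundForm, covDerivAlong_eq hf, covDeriv_congr h, covDeriv, hf.fderiv_eq]
  simp

/-- The Christoffel term is additive in its second slot, and the absence of torsion moves X there.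
-/
theorem covDeriv_add_left (G : Coord n → Form n) (hG : IsMetricAt G u) (V : Coord n → Coord n)
    (X X' : Coord n) : covDeriv G V (X + X') u = covDeriv G V X u + covDeriv G V X' u := by
  simp only [covDeriv, map_add, hG.christoffel_symm _ (V u), christoffel_add_right]
  abel

theorem covDeriv_smul_left (G : Coord n → Form n) (hG : IsMetricAt G u) (V : Coord n → Coord n)
    (X : Coord n) (c : ℝ) : covDeriv G V (c • X) u = c • covDeriv G V X u := by
  simp only [covDeriv, map_smul, hG.christoffel_symm _ (V u), christoffel_smul_right, smul_add]

/-- The endomorphism `X ↦ ∇_X V` at `u`. -/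
def covDerivLin (hG : IsMetricAt G u) (V : Coord n → Coord n) : Coord n →ₗ[ℝ] Coord n where
  toFun X := covDeriv G V X u
  map_add' := covDeriv_add_left G hG V
  map_smul' c X := covDeriv_smul_left G hG V X c

theorem IsMetricAt.contDiffAt_covDeriv (hG : IsMetricAt G u) {V : Coord n → Coord n}
    (hV : ContDiffAt ℝ ∞ V u) (X : Coord n) : ContDiffAt ℝ ∞ (fun w => covDeriv G V X w) u :=
  ((hV.fderiv_right (by simp)).clm_apply contDiffAt_const).add
    (hG.contDiffAt_christoffel contDiffAt_const hV)

/-! ### The gradient of a function -/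

theorem fderiv_fderiv_apply (hW : IsGradAt G r W u) (X Y : Coord n) :
    fderiv ℝ (fun w => fderiv ℝ r w Y) u X = fderiv ℝ (fderiv ℝ r) u X Y := by
  rw [(hW.differentiableAt_fderiv.hasFDerivAt.clm_apply (hasFDerivAt_const Y u)).fderiv]
  simp

/-- The covariant Hessian of `r` in terms of its gradient. -/
theorem IsGradAt.hessian (hG : IsMetricAt G u) (hW : IsGradAt G r W u) (X Y : Coord n) :
    fderiv ℝ (fderiv ℝ r) u X Y
      = G u (covDeriv G W X u) Y + fderiv ℝ r u (christoffel G u X Y) := by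
  have hWd : DifferentiableAt ℝ W u := (hW.contDiffAt_grad hG).differentiableAt (by simp)
  -- The Hessian arises by differentiating dr(Y) = G(W,Y) and using metric compatibility.
  have h : (fun w => fderiv ℝ r w Y) =ᶠ[𝓝 u] fun w => G w (W w) Y := by
    filter_upwards [hW] with w hw using (hw.2 Y).symm
  rw [← fderiv_fderiv_apply hW, h.fderiv_eq, ((hG.differentiableAt.hasFDerivAt.clm_apply
    hWd.hasFDerivAt).clm_apply (hasFDerivAt_const Y u)).fderiv]
  simp [covDeriv, hG.fderiv_eq, ← hW.inner]
  ring

theorem IsGradAt.hessian_symm (hW : IsGradAt G r W u) (X Y : Coord n) :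
    fderiv ℝ (fderiv ℝ r) u X Y = fderiv ℝ (fderiv ℝ r) u Y X :=
  (hW.contDiffAt.isSymmSndFDerivAt (by
    rw [minSmoothness_of_isRCLikeNormedField]
    exact ENat.LEInfty.out)).eq X Y

/-- Second derivatives of r commute and the connection has no torsion, so the endomorphism X ↦ ∇_X W
is self-adjoint. -/
theorem IsGradAt.covDeriv_symm (hG : IsMetricAt G u) (hW : IsGradAt G r W u) (X Y : Coord n) :
    G u (covDeriv G W X u) Y = G u (covDeriv G W Y u) X := by
  have h1 := hW.hessian hG X Y
  rw [hW.hessian_symm, hW.hessian hG, hG.christoffel_symm] at h1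
  linarith

/-- The derivative of the squared length of the gradient. -/
theorem IsGradAt.fderiv_normSq (hG : IsMetricAt G u) (hW : IsGradAt G r W u) (X : Coord n) :
    fderiv ℝ (fun w => fderiv ℝ r w (W w)) u X = 2 * fderiv ℝ r u (covDeriv G W X u) := by
  have hWd : DifferentiableAt ℝ W u := (hW.contDiffAt_grad hG).differentiableAt (by simp)
  have h : (fun w => fderiv ℝ r w (W w)) =ᶠ[𝓝 u] fun w => G w (W w) (W w) := by
    filter_upwards [hW] with w hw using (hw.2 _).symm
  rw [h.fderiv_eq, ((hG.differentiableAt.hasFDerivAt.clm_apply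
    hWd.hasFDerivAt).clm_apply hWd.hasFDerivAt).fderiv]
  simp [covDeriv, hG.fderiv_eq, ← hW.inner, hG.isInner.symm _ (W u)]
  ring

end Calculus


/-! ### Effect of a conformal change on connection, second derivatives and curvature. -/

section Conformal

open Filter Topology

variable {n : ℕ} {G : Coord n → Form n} {r : Coord n → ℝ} {W : Coord n → Coord n} {u : Coord n}

/-- The metric `e^{2r} G`. -/
def conf (r : Coord n → ℝ) (G : Coord n → Form n) (w : Coord n) : Form n :=
  Real.exp (2 * r w) • G w

theorem contDiffAt_smul_fun {E F : Type*} [NormedAddCommGroup E] [NormedSpace ℝ E]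
    [NormedAddCommGroup F] [NormedSpace ℝ F] {f : E → ℝ} {g : E → F} {u : E}
    (hf : ContDiffAt ℝ ∞ f u) (hg : ContDiffAt ℝ ∞ g u) :
    ContDiffAt ℝ ∞ (fun w => f w • g w) u :=
  hf.smul hg

theorem fderiv_smul_fun {E F : Type*} [NormedAddCommGroup E] [NormedSpace ℝ E]
    [NormedAddCommGroup F] [NormedSpace ℝ F] {f : E → ℝ} {g : E → F} {u : E}
    (hf : DifferentiableAt ℝ f u) (hg : DifferentiableAt ℝ g u) (X : E) :
    fderiv ℝ (fun w => f w • g w) u X = f u • fderiv ℝ g u X + fderiv ℝ f u X • g u := by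
  rw [fderiv_fun_smul hf hg]
  simp

theorem IsMetricAt.conf (hG : IsMetricAt G u) (hW : IsGradAt G r W u) :
    IsMetricAt (conf r G) u := by
  filter_upwards [hG, hW] with w h1 h2
  exact ⟨contDiffAt_smul_fun (contDiffAt_const.mul h2.1).exp h1.1, h1.2.smul (Real.exp_pos _)⟩

theorem IsGradAt.fderiv_exp (hW : IsGradAt G r W u) (c : ℝ) (X : Coord n) :
    fderiv ℝ (fun w => Real.exp (c * r w)) u X = Real.exp (c * r u) * (c * fderiv ℝ r u X) := by
  rw [((hW.differentiableAt.hasFDerivAt.const_mul c).exp).fderiv]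
  simp

theorem fderiv_conf (hG : IsMetricAt G u) (hW : IsGradAt G r W u) (X Y Z : Coord n) :
    fderiv ℝ (conf r G) u X Y Z
      = Real.exp (2 * r u) * (2 * fderiv ℝ r u X * G u Y Z + fderiv ℝ G u X Y Z) := by
  have hg : DifferentiableAt ℝ (fun w => G w Y Z) u :=
    (hG.differentiableAt.clm_apply (differentiableAt_const Y)).clm_apply (differentiableAt_const Z)
  rw [← fderiv_form_apply (hG.conf hW).differentiableAt, ← fderiv_form_apply hG.differentiableAt]
  simp only [conf, smul_apply, smul_eq_mul]
  have h := fderiv_smul_fun (hW.differentiableAt.const_mul 2).exp hg X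
  simp only [smul_eq_mul] at h
  rw [h, hW.fderiv_exp]
  ring

/-- The Christoffel symbols of a conformally equivalent metric. -/
theorem christoffel_conf (hG : IsMetricAt G u) (hW : IsGradAt G r W u) (X Y : Coord n) :
    christoffel (conf r G) u X Y = christoffel G u X Y
      + (fderiv ℝ r u X • Y + fderiv ℝ r u Y • X - G u X Y • W u) := by
  refine (hG.conf hW).isInner.ext fun Z => ?_
  rw [(hG.conf hW).isInner.christoffel_inner, fderiv_conf hG hW, fderiv_conf hG hW,
    fderiv_conf hG hW]
  simp only [conf, smul_apply, map_add, map_sub, map_smul, add_apply, sub_apply, smul_eq_mul,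
    hG.isInner.christoffel_inner, hW.inner]
  rw [hG.isInner.symm Y Z, hG.isInner.symm X Z, hG.isInner.symm X Y]
  ring

/-- The covariant derivative of the gradient for the conformally equivalent metric. -/
theorem covDeriv_conf (hG : IsMetricAt G u) (hW : IsGradAt G r W u) (Y : Coord n) :
    covDeriv (conf r G) W Y u = covDeriv G W Y u + fderiv ℝ r u (W u) • Y := by
  -- Since G(Y,W) = dr(Y), two terms of the difference tensor cancel and only |W|²Y is left.
  rw [covDeriv, covDeriv, christoffel_conf hG hW, hG.isInner.symm, hW.inner]
  module

theorem covDeriv_smul (hW : IsGradAt G r W u) (hWd : DifferentiableAt ℝ W u) (c : ℝ)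
    (Y : Coord n) :
    covDeriv G (fun w => Real.exp (c * r w) • W w) Y u
      = Real.exp (c * r u) • (covDeriv G W Y u + (c * fderiv ℝ r u Y) • W u) := by
  rw [covDeriv, covDeriv, fderiv_smul_fun (hW.differentiableAt.const_mul c).exp hWd,
    hW.fderiv_exp, christoffel_smul_right]
  module

theorem IsGradAt.differentiableAt_normSq (hG : IsMetricAt G u) (hW : IsGradAt G r W u) :
    DifferentiableAt ℝ (fun w => fderiv ℝ r w (W w)) u :=
  (hW.contDiffAt_fderiv.clm_apply (hW.contDiffAt_grad hG)).differentiableAt (by simp)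

/-- Only the connection acting on the field changes, the domain keeping G. So ∇_Y W + |W|²Y, valid
near u, is differentiated with the new Christoffel symbols. -/
theorem covHessian_conf (hG : IsMetricAt G u) (hW : IsGradAt G r W u) (X Y : Coord n) :
    covHessian G (conf r G) W u X Y = covHessian G G W u X Y
      + (fderiv ℝ (fun w => fderiv ℝ r w (W w)) u X • Y
        + fderiv ℝ r u X • covDeriv G W Y u + fderiv ℝ r u (covDeriv G W Y u) • X
        + fderiv ℝ r u (W u) • (fderiv ℝ r u X • Y) + fderiv ℝ r u (W u) • (fderiv ℝ r u Y • X)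
        - G u X (covDeriv G W Y u) • W u - fderiv ℝ r u (W u) • (G u X Y • W u)) := by
  have hA : DifferentiableAt ℝ (fun w => covDeriv G W Y w) u :=
    (hG.contDiffAt_covDeriv (hW.contDiffAt_grad hG) Y).differentiableAt (by simp)
  have h : (fun w => covDeriv (conf r G) W Y w) =ᶠ[𝓝 u]
      fun w => covDeriv G W Y w + fderiv ℝ r w (W w) • Y := by
    filter_upwards [hG.eventually, hW.eventually] with w h1 h2 using covDeriv_conf h1 h2 Y
  have hq := hW.differentiableAt_normSq hG
  have hd : fderiv ℝ (fun w => covDeriv G W Y w + fderiv ℝ r w (W w) • Y) u X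
      = fderiv ℝ (fun w => covDeriv G W Y w) u X
        + fderiv ℝ (fun w => fderiv ℝ r w (W w)) u X • Y := by
    rw [fderiv_fun_add hA (hq.smul_const Y), fderiv_smul_const hq]
    simp
  have h1 : covHessian G (conf r G) W u X Y = fderiv ℝ (fun w => covDeriv G W Y w) u X
        + fderiv ℝ (fun w => fderiv ℝ r w (W w)) u X • Y
      + christoffel (conf r G) u X (covDeriv G W Y u + fderiv ℝ r u (W u) • Y)
      - (covDeriv G W (christoffel G u X Y) u + fderiv ℝ r u (W u) • christoffel G u X Y) := by
    rw [covHessian, covDeriv_congr h, covDeriv_conf hG hW, covDeriv, hd]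
  have h2 : covHessian G G W u X Y = fderiv ℝ (fun w => covDeriv G W Y w) u X
      + christoffel G u X (covDeriv G W Y u) - covDeriv G W (christoffel G u X Y) u := rfl
  rw [h1, h2, christoffel_conf hG hW, christoffel_add_right, christoffel_smul_right]
  simp only [map_add, map_smul, smul_eq_mul]
  module

/-- Here the connection on the field is that of G, and the domain carries e^{2r}G. The 3's are 2
from the product rule for e^{-2r} plus 1 from the domain's difference tensor; the 8 is 4 from
differentiating e^{-2r} twice plus 4 from applying dr to that tensor. -/
theorem covHessian_smul (hG : IsMetricAt G u) (hW : IsGradAt G r W u) (X Y : Coord n) :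
    covHessian (conf r G) G (fun w => Real.exp (-2 * r w) • W w) u X Y
      = Real.exp (-2 * r u) • (covHessian G G W u X Y
        - (2 : ℝ) • (G u (covDeriv G W X u) Y • W u)
        - (3 : ℝ) • (fderiv ℝ r u Y • covDeriv G W X u)
        - (3 : ℝ) • (fderiv ℝ r u X • covDeriv G W Y u)
        + (8 : ℝ) • (fderiv ℝ r u X • (fderiv ℝ r u Y • W u))
        + G u X Y • covDeriv G W (W u) u
        - (2 * fderiv ℝ r u (W u)) • (G u X Y • W u)) := by
  have hWs := hW.contDiffAt_grad hG
  have hWd : DifferentiableAt ℝ W u := hWs.differentiableAt (by simp)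
  have hA : DifferentiableAt ℝ (fun w => covDeriv G W Y w) u :=
    (hG.contDiffAt_covDeriv hWs Y).differentiableAt (by simp)
  have hrY : DifferentiableAt ℝ (fun w => -2 * fderiv ℝ r w Y) u :=
    (hW.differentiableAt_fderiv.clm_apply (differentiableAt_const Y)).const_mul _
  have h : (fun w => covDeriv G (fun w => Real.exp (-2 * r w) • W w) Y w) =ᶠ[𝓝 u]
      fun w => Real.exp (-2 * r w) • (covDeriv G W Y w + (-2 * fderiv ℝ r w Y) • W w) := by
    filter_upwards [hG.eventually, hW.eventually] with w h1 h2
    exact covDeriv_smul h2 ((h2.contDiffAt_grad h1).differentiableAt (by simp)) _ _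
  have hd : fderiv ℝ (fun w => covDeriv G W Y w + (-2 * fderiv ℝ r w Y) • W w) u X
      = fderiv ℝ (fun w => covDeriv G W Y w) u X
        + ((-2 * fderiv ℝ r u Y) • fderiv ℝ W u X
        + (-2 * (G u (covDeriv G W X u) Y + fderiv ℝ r u (christoffel G u X Y))) • W u) := by
    rw [fderiv_fun_add hA (hrY.fun_smul hWd), ← hW.hessian hG, ← fderiv_fderiv_apply hW, add_apply,
      fderiv_smul_fun hrY hWd, fderiv_const_mul
        (hW.differentiableAt_fderiv.clm_apply (differentiableAt_const Y))]
    simp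
  have h1 : covHessian (conf r G) G (fun w => Real.exp (-2 * r w) • W w) u X Y
      = Real.exp (-2 * r u) • (fderiv ℝ (fun w => covDeriv G W Y w) u X
        + ((-2 * fderiv ℝ r u Y) • fderiv ℝ W u X
        + (-2 * (G u (covDeriv G W X u) Y + fderiv ℝ r u (christoffel G u X Y))) • W u))
      + (Real.exp (-2 * r u) * (-2 * fderiv ℝ r u X)) •
        (covDeriv G W Y u + (-2 * fderiv ℝ r u Y) • W u)
      + Real.exp (-2 * r u) • (christoffel G u X (covDeriv G W Y u)
        + (-2 * fderiv ℝ r u Y) • christoffel G u X (W u))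
      - Real.exp (-2 * r u) • (covDeriv G W (christoffel (conf r G) u X Y) u
        + (-2 * fderiv ℝ r u (christoffel (conf r G) u X Y)) • W u) := by
    rw [covHessian, covDeriv_congr h, covDeriv_smul hW hWd, covDeriv,
      fderiv_smul_fun (hW.differentiableAt.const_mul _).exp (hA.fun_add (hrY.fun_smul hWd)), hd,
      hW.fderiv_exp, christoffel_smul_right, christoffel_add_right, christoffel_smul_right]
  have h2 : covHessian G G W u X Y = fderiv ℝ (fun w => covDeriv G W Y w) u X
      + christoffel G u X (covDeriv G W Y u) - covDeriv G W (christoffel G u X Y) u := rfl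
  have h3 : fderiv ℝ W u X = covDeriv G W X u - christoffel G u X (W u) := by
    rw [covDeriv]
    abel
  have h4 : covDeriv G W (christoffel (conf r G) u X Y) u = covDeriv G W (christoffel G u X Y) u
      + (fderiv ℝ r u X • covDeriv G W Y u + fderiv ℝ r u Y • covDeriv G W X u
        - G u X Y • covDeriv G W (W u) u) := by
    rw [christoffel_conf hG hW]
    change covDerivLin hG W _ = _
    simp only [map_add, map_sub, map_smul]
    rfl
  rw [h1, h2, h3, h4, christoffel_conf hG hW]
  simp only [map_add, map_sub, map_smul, smul_eq_mul]
  module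

/-- The derivative of the difference tensor gives the terms in ∇W. Because the second argument is W
itself, the remaining terms, without ∇W, cancel. -/
theorem curvature_conf (hG : IsMetricAt G u) (hW : IsGradAt G r W u) (X Y : Coord n) :
    curvature (conf r G) u X (W u) Y = curvature G u X (W u) Y
      + (G u (covDeriv G W X u) Y • W u - G u (covDeriv G W (W u) u) Y • X
        - fderiv ℝ r u Y • covDeriv G W X u + G u X Y • covDeriv G W (W u) u) := by
  have hWd : DifferentiableAt ℝ W u := (hW.contDiffAt_grad hG).differentiableAt (by simp)
  have hd : ∀ X Y Z, fderiv ℝ (fun w => christoffel (conf r G) w Y Z) u X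
      = fderiv ℝ (fun w => christoffel G w Y Z) u X
        + (fderiv ℝ (fderiv ℝ r) u X Y • Z + fderiv ℝ (fderiv ℝ r) u X Z • Y
          - (G u Y Z • (covDeriv G W X u - christoffel G u X (W u))
            + fderiv ℝ G u X Y Z • W u)) := by
    intro X Y Z
    have h : (fun w => christoffel (conf r G) w Y Z) =ᶠ[𝓝 u] fun w => christoffel G w Y Z
        + (fderiv ℝ r w Y • Z + fderiv ℝ r w Z • Y - G w Y Z • W w) := by
      filter_upwards [hG.eventually, hW.eventually] with w h1 h2 using christoffel_conf h1 h2 Y Z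
    have hΓ : DifferentiableAt ℝ (fun w => christoffel G w Y Z) u :=
      (hG.contDiffAt_christoffel contDiffAt_const contDiffAt_const).differentiableAt (by simp)
    have hr : ∀ Y, DifferentiableAt ℝ (fun w => fderiv ℝ r w Y) u := fun Y =>
      hW.differentiableAt_fderiv.clm_apply (differentiableAt_const Y)
    have hg : DifferentiableAt ℝ (fun w => G w Y Z) u :=
      (hG.differentiableAt.clm_apply (differentiableAt_const Y)).clm_apply
        (differentiableAt_const Z)
    have h3 : covDeriv G W X u - christoffel G u X (W u) = fderiv ℝ W u X := by
      rw [covDeriv]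
      abel
    rw [h.fderiv_eq, fderiv_fun_add hΓ ((((hr Y).smul_const Z).fun_add ((hr Z).smul_const Y)).fun_sub
      (hg.fun_smul hWd)), fderiv_fun_sub (((hr Y).smul_const Z).fun_add ((hr Z).smul_const Y))
      (hg.fun_smul hWd), fderiv_fun_add ((hr Y).smul_const Z) ((hr Z).smul_const Y),
      fderiv_smul_const (hr Y), fderiv_smul_const (hr Z), h3]
    simp only [add_apply, sub_apply, ContinuousLinearMap.smulRight_apply, fderiv_fderiv_apply hW,
      fderiv_smul_fun hg hWd, fderiv_form_apply hG.differentiableAt]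
  have h3 : covDeriv G W (W u) u = fderiv ℝ W u (W u) + christoffel G u (W u) (W u) := rfl
  have h4 := hW.covDeriv_symm hG X (W u)
  have h5 := hW.covDeriv_symm hG Y (W u)
  rw [curvature, curvature, hd, hd, hW.hessian hG, hW.hessian hG, hW.hessian hG,
    hW.hessian_symm (W u), hW.hessian hG, hG.fderiv_eq, hG.fderiv_eq]
  simp only [christoffel_conf hG hW, christoffel_add_right, christoffel_sub_right,
    christoffel_smul_right, map_add, map_sub, map_smul, hG.christoffel_symm (W u) X, hW.inner, h4,
    h5, hG.christoffel_symm (W u) Y,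
    smul_eq_mul, hG.isInner.symm X (W u), hG.isInner.symm X (christoffel G u Y (W u))]
  module

end Conformal


/-! ### Traces: tension and bitension of the identity in coordinates. -/

section LocalBitension

open Filter Topology

variable {n : ℕ} {G : Coord n → Form n} {r : Coord n → ℝ} {W : Coord n → Coord n} {u : Coord n}

theorem metricTrace_conf {V : Type*} [AddCommGroup V] [Module ℝ V] (G : Coord n → Form n)
    (r : Coord n → ℝ) (u : Coord n) (T : Coord n → Coord n → V) :
    metricTrace (conf r G u) T = Real.exp (-2 * r u) • metricTrace (G u) T := by
  rw [conf, metricTrace_form_smul _ (Real.exp_pos _).ne', ← Real.exp_neg, neg_mul]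

theorem IsGradAt.trace_left {V : Type*} [AddCommGroup V] [Module ℝ V] (hG : IsMetricAt G u)
    (hW : IsGradAt G r W u) (L : Coord n →ₗ[ℝ] V) :
    metricTrace (G u) (fun X Y => fderiv ℝ r u X • L Y) = L (W u) :=
  hG.isInner.metricTrace_left (α := fderiv ℝ r u) hW.inner L

theorem IsGradAt.trace_right {V : Type*} [AddCommGroup V] [Module ℝ V] (hG : IsMetricAt G u)
    (hW : IsGradAt G r W u) (L : Coord n →ₗ[ℝ] V) :
    metricTrace (G u) (fun X Y => fderiv ℝ r u Y • L X) = L (W u) :=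
  hG.isInner.metricTrace_right (α := fderiv ℝ r u) hW.inner L

theorem trace_christoffel_conf (hG : IsMetricAt G u) (hW : IsGradAt G r W u) :
    metricTrace (G u) (fun X Y => christoffel (conf r G) u X Y - christoffel G u X Y)
      = (2 - n : ℝ) • W u := by
  simp only [christoffel_conf hG hW, add_sub_cancel_left, metricTrace_add, metricTrace_sub]
  rw [metricTrace_smul_const, hG.isInner.metricTrace_self]
  have h1 := hW.trace_left hG LinearMap.id
  have h2 := hW.trace_right hG LinearMap.id
  simp only [LinearMap.id_apply] at h1 h2
  rw [h1, h2]
  module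

/-- The tension field of the identity map from `G` to `e^{2r} G`. -/
theorem trace_secondFundForm_conf {f : Coord n → Coord n} (hf : f =ᶠ[𝓝 u] id)
    (hG : IsMetricAt G u) (hW : IsGradAt G r W u) :
    metricTrace (G u) (secondFundForm G (conf r G) f u) = (2 - n : ℝ) • W u := by
  rw [← trace_christoffel_conf hG hW]
  congr 1
  funext X Y
  exact secondFundForm_eq hf _ _ X Y

/-- The tension field of the identity map from `e^{2r} G` to `G`. -/
theorem trace_secondFundForm_conf' {f : Coord n → Coord n} (hf : f =ᶠ[𝓝 u] id)
    (hG : IsMetricAt G u) (hW : IsGradAt G r W u) :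
    metricTrace (conf r G u) (secondFundForm (conf r G) G f u)
      = (n - 2 : ℝ) • (Real.exp (-2 * r u) • W u) := by
  have h : secondFundForm (conf r G) G f u
      = fun X Y => (-1 : ℝ) • (christoffel (conf r G) u X Y - christoffel G u X Y) := by
    funext X Y
    rw [secondFundForm_eq hf]
    module
  rw [metricTrace_conf, h, metricTrace_smul, trace_christoffel_conf hG hW]
  module

/-- The bitension field of the identity map with tension field `V`. -/
def localBitension (G₁ G₂ : Coord n → Form n) (V : Coord n → Coord n) (u : Coord n) : Coord n :=
  metricTrace (G₁ u) (covHessian G₁ G₂ V u)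
    - metricTrace (G₁ u) (fun X Y => curvature G₂ u X (V u) Y)

/-- No differentiability is needed: c is either zero or invertible. -/
theorem fderiv_const_smul_fun {E F : Type*} [NormedAddCommGroup E] [NormedSpace ℝ E]
    [NormedAddCommGroup F] [NormedSpace ℝ F] (f : E → F) (c : ℝ) (u : E) :
    fderiv ℝ (fun w => c • f w) u = c • fderiv ℝ f u := by
  rcases eq_or_ne c 0 with rfl | hc
  · simp
  · have := invertibleOfNonzero hc
    exact fderiv_const_smul_of_invertible c

theorem covDeriv_const_smul (G : Coord n → Form n) (V : Coord n → Coord n) (c : ℝ)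
    (X : Coord n) :
    covDeriv G (fun w => c • V w) X u = c • covDeriv G V X u := by
  rw [covDeriv, covDeriv, christoffel_smul_right, fderiv_const_smul_fun]
  simp

theorem christoffel_smul_left (G : Coord n → Form n) (w X Y : Coord n) (c : ℝ) :
    christoffel G w (c • X) Y = c • christoffel G w X Y := by
  simp only [christoffel, map_smul, smul_apply, Finset.smul_sum, smul_smul, smul_eq_mul]
  refine Finset.sum_congr rfl fun k _ => Finset.sum_congr rfl fun l _ => ?_
  congr 1
  ring

theorem curvature_smul (G : Coord n → Form n) (X Z Y : Coord n) (c : ℝ) :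
    curvature G u X (c • Z) Y = c • curvature G u X Z Y := by
  simp only [curvature, christoffel_smul_left, christoffel_smul_right, map_smul,
    fderiv_const_smul_fun, smul_apply, smul_sub, smul_add]

theorem localBitension_smul (G₁ G₂ : Coord n → Form n) (V : Coord n → Coord n) (c : ℝ) :
    localBitension G₁ G₂ (fun w => c • V w) u = c • localBitension G₁ G₂ V u := by
  have h : covHessian G₁ G₂ (fun w => c • V w) u = fun X Y => c • covHessian G₁ G₂ V u X Y := by
    funext X Y
    simp only [covHessian, covDeriv_const_smul, smul_sub]
  simp only [localBitension, h, metricTrace_smul, curvature_smul, smul_sub]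

section

variable {Q : Coord n}

/-- By self-adjointness G(∇_W W, Y) = G(∇_Y W, W), which is half the derivative of |W|² along Y. -/
theorem IsGradAt.covDeriv_self (hG : IsMetricAt G u) (hW : IsGradAt G r W u)
    (hQ : ∀ Y, G u Q Y = fderiv ℝ (fun w => fderiv ℝ r w (W w)) u Y) :
    covDeriv G W (W u) u = (2⁻¹ : ℝ) • Q := by
  refine hG.isInner.ext fun Y => ?_
  rw [map_smul, smul_apply, hQ, hW.fderiv_normSq hG, hW.covDeriv_symm hG,
    hG.isInner.symm, hW.inner, smul_eq_mul]
  ring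

/-- The divergence of `V`. -/
def divergence (G : Coord n → Form n) (V : Coord n → Coord n) (u : Coord n) : ℝ :=
  metricTrace (G u) fun X Y => G u (covDeriv G V X u) Y

/-- The Hessian trace contributes 2Q and the curvature trace, once subtracted, (1 - n/2)Q, whence
(6-n)/2. Each contributes one -div(W) W. -/
theorem localBitension_conf (hG : IsMetricAt G u) (hW : IsGradAt G r W u)
    (hQ : ∀ Y, G u Q Y = fderiv ℝ (fun w => fderiv ℝ r w (W w)) u Y) :
    localBitension G (conf r G) W u = localBitension G G W u + ((6 - n) / 2 : ℝ) • Q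
      + ((2 - n) * fderiv ℝ r u (W u)) • W u - (2 * divergence G W u) • W u := by
  have hA := hW.covDeriv_self hG hQ
  have hdr : ∀ Y, fderiv ℝ r u (covDeriv G W Y u)
      = 2⁻¹ * fderiv ℝ (fun w => fderiv ℝ r w (W w)) u Y := fun Y => by
    rw [hW.fderiv_normSq hG]
    ring
  have hs : ∀ X Y, G u X (covDeriv G W Y u) = G u (covDeriv G W X u) Y := fun X Y => by
    rw [hG.isInner.symm, hW.covDeriv_symm hG]
  have hQ1 := hG.isInner.metricTrace_left hQ LinearMap.id
  have hQ2 := hG.isInner.metricTrace_right hQ LinearMap.id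
  have h1 := hW.trace_left hG LinearMap.id
  have h2 := hW.trace_right hG LinearMap.id
  have h3 : metricTrace (G u) (fun X Y => fderiv ℝ r u X • covDeriv G W Y u) = (2⁻¹ : ℝ) • Q :=
    (hW.trace_left hG (covDerivLin hG W)).trans hA
  have h4 : metricTrace (G u) (fun X Y => fderiv ℝ r u Y • covDeriv G W X u) = (2⁻¹ : ℝ) • Q :=
    (hW.trace_right hG (covDerivLin hG W)).trans hA
  simp only [LinearMap.id_apply] at hQ1 hQ2 h1 h2
  have e1 : metricTrace (G u) (covHessian G (conf r G) W u)
      = metricTrace (G u) (covHessian G G W u) + (Q + (2⁻¹ : ℝ) • Q + (2⁻¹ : ℝ) • Q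
        + fderiv ℝ r u (W u) • W u + fderiv ℝ r u (W u) • W u - divergence G W u • W u
        - fderiv ℝ r u (W u) • ((n : ℝ) • W u)) := by
    have h : covHessian G (conf r G) W u = fun X Y => _ :=
      funext fun X => funext fun Y => covHessian_conf hG hW X Y
    simp only [hdr, hs, mul_smul] at h
    rw [h]
    simp only [metricTrace_add, metricTrace_sub]
    simp only [metricTrace_smul, metricTrace_smul_const _ (fun X Y => G u X Y),
      metricTrace_smul_const _ (fun X Y => G u (covDeriv G W X u) Y), hQ1, hQ2, h1, h2, h3,
      hG.isInner.metricTrace_self]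
    rfl
  have e2 : metricTrace (G u) (fun X Y => curvature (conf r G) u X (W u) Y)
      = metricTrace (G u) (fun X Y => curvature G u X (W u) Y)
        + (divergence G W u • W u - (2⁻¹ : ℝ) • Q - (2⁻¹ : ℝ) • Q + (n : ℝ) • ((2⁻¹ : ℝ) • Q)) := by
    simp only [curvature_conf hG hW, hA, map_smul, smul_apply, hQ, smul_eq_mul, mul_smul,
      metricTrace_add, metricTrace_sub]
    simp only [metricTrace_smul, metricTrace_smul_const _ (fun X Y => G u X Y),
      metricTrace_smul_const _ (fun X Y => G u (covDeriv G W X u) Y), hQ2, h4,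
      hG.isInner.metricTrace_self]
    rfl
  rw [localBitension, localBitension, e1, e2]
  module

/-- The curvature is that of G, so it only rescales. One factor e^{-2r} comes from the trace for
e^{2r}G, the other from the field. -/
theorem localBitension_conf' (hG : IsMetricAt G u) (hW : IsGradAt G r W u)
    (hQ : ∀ Y, G u Q Y = fderiv ℝ (fun w => fderiv ℝ r w (W w)) u Y) :
    localBitension (conf r G) G (fun w => Real.exp (-2 * r w) • W w) u
      = Real.exp (-4 * r u) • (localBitension G G W u + ((n - 6) / 2 : ℝ) • Q
        + ((8 - 2 * n) * fderiv ℝ r u (W u)) • W u - (2 * divergence G W u) • W u) := by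
  have hA := hW.covDeriv_self hG hQ
  have h3 : metricTrace (G u) (fun X Y => fderiv ℝ r u X • covDeriv G W Y u) = (2⁻¹ : ℝ) • Q :=
    (hW.trace_left hG (covDerivLin hG W)).trans hA
  have h4 : metricTrace (G u) (fun X Y => fderiv ℝ r u Y • covDeriv G W X u) = (2⁻¹ : ℝ) • Q :=
    (hW.trace_right hG (covDerivLin hG W)).trans hA
  have h5 : metricTrace (G u) (fun X Y => fderiv ℝ r u X • (fderiv ℝ r u Y • W u))
      = fderiv ℝ r u (W u) • W u :=
    hW.trace_left hG ((fderiv ℝ r u).smulRight (W u)).toLinearMap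
  have e1 : metricTrace (G u) (covHessian (conf r G) G (fun w => Real.exp (-2 * r w) • W w) u)
      = Real.exp (-2 * r u) • (metricTrace (G u) (covHessian G G W u)
        - (2 : ℝ) • (divergence G W u • W u) - (3 : ℝ) • ((2⁻¹ : ℝ) • Q)
        - (3 : ℝ) • ((2⁻¹ : ℝ) • Q) + (8 : ℝ) • (fderiv ℝ r u (W u) • W u)
        + (n : ℝ) • ((2⁻¹ : ℝ) • Q) - (2 * fderiv ℝ r u (W u)) • ((n : ℝ) • W u)) := by
    have h : covHessian (conf r G) G (fun w => Real.exp (-2 * r w) • W w) u = fun X Y => _ :=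
      funext fun X => funext fun Y => covHessian_smul hG hW X Y
    rw [h]
    simp only [metricTrace_smul, metricTrace_add, metricTrace_sub, hA]
    simp only [metricTrace_smul_const _ (fun X Y => G u X Y),
      metricTrace_smul_const _ (fun X Y => G u (covDeriv G W X u) Y), h3, h4, h5,
      hG.isInner.metricTrace_self]
    rfl
  have he : Real.exp (-4 * r u) = Real.exp (-2 * r u) * Real.exp (-2 * r u) := by
    rw [← Real.exp_add]
    ring_nf
  simp only [localBitension, metricTrace_conf, e1, curvature_smul, metricTrace_smul, he]
  module

/-- The relation between the bitension fields of the identity maps `G → e^{2r} G` and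
`e^{2r} G → G`. -/
theorem localBitension_add (hG : IsMetricAt G u) (hW : IsGradAt G r W u)
    (hQ : ∀ Y, G u Q Y = fderiv ℝ (fun w => fderiv ℝ r w (W w)) u Y) :
    localBitension (conf r G) G (fun w => (n - 2 : ℝ) • (Real.exp (-2 * r w) • W w)) u
      + Real.exp (-4 * r u) • localBitension G (conf r G) (fun w => (2 - n : ℝ) • W w) u
      = (Real.exp (-4 * r u) * (n - 2) * (n - 6)) • (Q - fderiv ℝ r u (W u) • W u) := by
  rw [localBitension_smul, localBitension_smul, localBitension_conf hG hW hQ,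
    localBitension_conf' hG hW hQ]
  module

end

end LocalBitension


/-! ### Transfer between the manifold and its charts. -/

section Charts

open Filter Topology

variable {n : ℕ} {N : Type*} [TopologicalSpace N] [ChartedSpace (EuclideanSpace ℝ (Fin n)) N]

theorem eventually_mem_target (x : N) :
    ∀ᶠ w in 𝓝 (extChartAt (𝓡 n) x x), w ∈ (extChartAt (𝓡 n) x).target :=
  extChartAt_target_mem_nhds x

theorem symm_mem_source {x : N} {w : Coord n} (hw : w ∈ (extChartAt (𝓡 n) x).target) :
    (extChartAt (𝓡 n) x).symm w ∈ (chartAt (Coord n) x).source := by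
  rw [← extChartAt_source (𝓡 n)]
  exact (extChartAt (𝓡 n) x).map_target hw

theorem writtenInExtChartAt_id_eventuallyEq (x : N) :
    writtenInExtChartAt (𝓡 n) (𝓡 n) x (id : N → N) =ᶠ[𝓝 (extChartAt (𝓡 n) x x)] id := by
  filter_upwards [eventually_mem_target x] with w hw
  exact (extChartAt (𝓡 n) x).right_inv hw

variable [IsManifold (𝓡 n) ∞ N]

theorem toCoord_ofCoord {x p : N} (hp : p ∈ (chartAt (Coord n) x).source) (X : Coord n) :
    toCoord x p (ofCoord x p X) = X :=
  (trivializationAt (Coord n) (TangentSpace (𝓡 n)) x).continuousLinearMapAt_symmL (R := ℝ)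
    (by simpa using hp) X

theorem ofCoord_toCoord {x p : N} (hp : p ∈ (chartAt (Coord n) x).source)
    (v : TangentSpace (𝓡 n) p) : ofCoord x p (toCoord x p v) = v :=
  (trivializationAt (Coord n) (TangentSpace (𝓡 n)) x).symmL_continuousLinearMapAt (R := ℝ)
    (by simpa using hp) v

theorem contMDiffAt_symm {x : N} {w : Coord n} (hw : w ∈ (extChartAt (𝓡 n) x).target) :
    ContMDiffAt 𝓘(ℝ, Coord n) (𝓡 n) ∞ (extChartAt (𝓡 n) x).symm w :=
  (contMDiffOn_extChartAt_symm x).contMDiffAt ((isOpen_extChartAt_target x).mem_nhds hw)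

/-- `ofCoord` is the differential of the inverse chart, so this is the chain rule. -/
theorem mfderiv_ofCoord {x : N} {w : Coord n} (hw : w ∈ (extChartAt (𝓡 n) x).target) {f : N → ℝ}
    (hf : MDifferentiableAt (𝓡 n) 𝓘(ℝ, ℝ) f ((extChartAt (𝓡 n) x).symm w)) (Y : Coord n) :
    mfderiv (𝓡 n) 𝓘(ℝ, ℝ) f ((extChartAt (𝓡 n) x).symm w)
        (ofCoord x ((extChartAt (𝓡 n) x).symm w) Y)
      = fderiv ℝ (fun w => f ((extChartAt (𝓡 n) x).symm w)) w Y := by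
  have h1 : MDifferentiableAt 𝓘(ℝ, Coord n) (𝓡 n) (extChartAt (𝓡 n) x).symm w :=
    (contMDiffAt_symm hw).mdifferentiableAt (by simp)
  have h2 : ofCoord x ((extChartAt (𝓡 n) x).symm w)
      = mfderiv 𝓘(ℝ, Coord n) (𝓡 n) (extChartAt (𝓡 n) x).symm w := by
    have := TangentBundle.symmL_trivializationAt (I := 𝓡 n) (symm_mem_source hw)
    rw [(extChartAt (𝓡 n) x).right_inv hw, modelWithCornersSelf_coe, Set.range_id,
      mfderivWithin_univ] at this
    exact this
  have h3 := mfderiv_comp w hf h1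
  rw [mfderiv_eq_fderiv] at h3
  change _ = fderiv ℝ (f ∘ (extChartAt (𝓡 n) x).symm) w Y
  rw [h3, h2]
  rfl

set_option synthInstance.maxHeartbeats 400000 in
set_option maxHeartbeats 1000000 in
-- `localMetric h x` is the section h read in the trivialization at x. Smoothness is needed
-- throughout the chart domain, not only at its centre.
theorem contDiffAt_localMetric (h : RiemMetric n N) {x : N} {w : Coord n}
    (hw : w ∈ (extChartAt (𝓡 n) x).target) : ContDiffAt ℝ ∞ (localMetric h x) w := by
  have hp := symm_mem_source hw
  have h1 := h.contMDiff ((extChartAt (𝓡 n) x).symm w)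
  rw [Trivialization.contMDiffAt_section_iff (e := trivializationAt (Form n)
    (fun y : N => TangentSpace (𝓡 n) y →L[ℝ] TangentSpace (𝓡 n) y →L[ℝ] ℝ) x)
    (by simpa using hp)] at h1
  have h2 := (h1.comp w (contMDiffAt_symm hw)).contDiffAt
  refine h2.congr_of_eventuallyEq ?_
  filter_upwards [(isOpen_extChartAt_target x).mem_nhds hw] with v hv
  have hb : (extChartAt (𝓡 n) x).symm v
      ∈ (trivializationAt (Coord n) (TangentSpace (𝓡 n)) x).baseSet := by
    simpa using symm_mem_source hv
  ext X Y
  refine Eq.trans ?_ (inCoordinates_apply_eq₂ (F₃ := ℝ) (E₃ := Bundle.Trivial N ℝ) hb hb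
    (Set.mem_univ _)).symm
  have hs : ∀ Z : Coord n, ofCoord x ((extChartAt (𝓡 n) x).symm v) Z
      = (trivializationAt (Coord n) (TangentSpace (𝓡 n)) x).symm
        ((extChartAt (𝓡 n) x).symm v) Z := fun Z =>
    Trivialization.symmL_apply (R := ℝ) _ hb Z
  rw [localMetric_apply, hs, hs]
  simp

theorem isInner_localMetric (h : RiemMetric n N) {x : N} {w : Coord n}
    (hw : w ∈ (extChartAt (𝓡 n) x).target) : IsInner (localMetric h x w) where
  symm X Y := h.symm _ _ _
  pos X hX := by
    refine h.pos _ _ fun h0 => hX ?_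
    exact (toCoord_ofCoord (symm_mem_source hw) X).symm.trans
      ((congrArg _ h0).trans (map_zero _))

theorem isMetricAt_localMetric (h : RiemMetric n N) (x : N) :
    IsMetricAt (localMetric h x) (extChartAt (𝓡 n) x x) := by
  filter_upwards [eventually_mem_target x] with w hw
  exact ⟨contDiffAt_localMetric h hw, isInner_localMetric h hw⟩

theorem localMetric_conformal (h : RiemMetric n N) (ρ : N → ℝ)
    (hρ : ContMDiff (𝓡 n) 𝓘(ℝ, ℝ) ∞ ρ) (x : N) :
    localMetric (conformal h ρ hρ) x
      = conf (fun w => ρ ((extChartAt (𝓡 n) x).symm w)) (localMetric h x) := by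
  funext w
  ext X Y
  rfl

/-- The gradient of `f` in the chart at `x`. -/
def localGrad (h : RiemMetric n N) (f : N → ℝ) (x : N) (w : Coord n) : Coord n :=
  toCoord x ((extChartAt (𝓡 n) x).symm w) (grad h f ((extChartAt (𝓡 n) x).symm w))

theorem localMetric_localGrad (h : RiemMetric n N) {x : N} {w : Coord n}
    (hw : w ∈ (extChartAt (𝓡 n) x).target) {f : N → ℝ}
    (hf : MDifferentiableAt (𝓡 n) 𝓘(ℝ, ℝ) f ((extChartAt (𝓡 n) x).symm w)) (Y : Coord n) :
    localMetric h x w (localGrad h f x w) Y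
      = fderiv ℝ (fun w => f ((extChartAt (𝓡 n) x).symm w)) w Y := by
  rw [localMetric_apply, localGrad, ofCoord_toCoord (symm_mem_source hw), inner_grad,
    mfderiv_ofCoord hw hf]

theorem isGradAt_localGrad (h : RiemMetric n N) {ρ : N → ℝ}
    (hρ : ContMDiff (𝓡 n) 𝓘(ℝ, ℝ) ∞ ρ) (x : N) :
    IsGradAt (localMetric h x) (fun w => ρ ((extChartAt (𝓡 n) x).symm w)) (localGrad h ρ x)
      (extChartAt (𝓡 n) x x) := by
  filter_upwards [eventually_mem_target x] with w hw
  refine ⟨((hρ _).comp w (contMDiffAt_symm hw)).contDiffAt, fun Y => ?_⟩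
  exact localMetric_localGrad h hw ((hρ _).mdifferentiableAt (by simp)) Y

theorem gradNormSq_symm (h : RiemMetric n N) {ρ : N → ℝ} (hρ : ContMDiff (𝓡 n) 𝓘(ℝ, ℝ) ∞ ρ)
    {x : N} {w : Coord n} (hw : w ∈ (extChartAt (𝓡 n) x).target) :
    gradNormSq h ρ ((extChartAt (𝓡 n) x).symm w)
      = fderiv ℝ (fun w => ρ ((extChartAt (𝓡 n) x).symm w)) w (localGrad h ρ x w) := by
  rw [gradNormSq, inner_grad, ← mfderiv_ofCoord hw ((hρ _).mdifferentiableAt (by simp)),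
    localGrad, ofCoord_toCoord (symm_mem_source hw)]

theorem gradNormSq_eq (h : RiemMetric n N) {ρ : N → ℝ} (hρ : ContMDiff (𝓡 n) 𝓘(ℝ, ℝ) ∞ ρ)
    (x : N) :
    gradNormSq h ρ x = fderiv ℝ (fun w => ρ ((extChartAt (𝓡 n) x).symm w))
      (extChartAt (𝓡 n) x x) (localGrad h ρ x (extChartAt (𝓡 n) x x)) := by
  rw [← gradNormSq_symm h hρ (mem_extChartAt_target x), extChartAt_to_inv]

/-- Needed because `grad` is built on `mfderiv`, whose value is 0 where differentiability fails. -/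
theorem mdifferentiableAt_gradNormSq (h : RiemMetric n N) {ρ : N → ℝ}
    (hρ : ContMDiff (𝓡 n) 𝓘(ℝ, ℝ) ∞ ρ) (x : N) :
    MDifferentiableAt (𝓡 n) 𝓘(ℝ, ℝ) (gradNormSq h ρ) x := by
  have hq := (isGradAt_localGrad h hρ x).differentiableAt_normSq (isMetricAt_localMetric h x)
  have hd := hq.mdifferentiableAt.comp x
    (mdifferentiableAt_extChartAt (I := 𝓡 n) (mem_chart_source (Coord n) x))
  refine hd.congr_of_eventuallyEq ?_
  filter_upwards [extChartAt_source_mem_nhds (I := 𝓡 n) x] with p hp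
  have := gradNormSq_symm h hρ ((extChartAt (𝓡 n) x).map_source hp)
  rwa [(extChartAt (𝓡 n) x).left_inv hp] at this

theorem localMetric_localGrad_gradNormSq (h : RiemMetric n N) {ρ : N → ℝ}
    (hρ : ContMDiff (𝓡 n) 𝓘(ℝ, ℝ) ∞ ρ) (x : N) (Y : Coord n) :
    localMetric h x (extChartAt (𝓡 n) x x)
        (localGrad h (gradNormSq h ρ) x (extChartAt (𝓡 n) x x)) Y
      = fderiv ℝ (fun w => fderiv ℝ (fun w => ρ ((extChartAt (𝓡 n) x).symm w)) w
          (localGrad h ρ x w)) (extChartAt (𝓡 n) x x) Y := by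
  rw [localMetric_localGrad h (mem_extChartAt_target x)
    (mdifferentiableAt_gradNormSq h hρ _)]
  refine congrArg (fun L : Coord n →L[ℝ] ℝ => L Y) (Filter.EventuallyEq.fderiv_eq ?_)
  filter_upwards [eventually_mem_target x] with w hw using gradNormSq_symm h hρ hw

theorem ofCoord_localGrad (h : RiemMetric n N) (f : N → ℝ) (x : N) :
    ofCoord x x (localGrad h f x (extChartAt (𝓡 n) x x)) = grad h f x := by
  have h1 := extChartAt_to_inv (I := 𝓡 n) x
  rw [localGrad, h1, ofCoord_toCoord (mem_chart_source _ x)]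

/-- The tension field of the identity map from `h` to `e^{2ρ} h`. -/
theorem tension_conformal (h : RiemMetric n N) {ρ : N → ℝ} (hρ : ContMDiff (𝓡 n) 𝓘(ℝ, ℝ) ∞ ρ)
    (x : N) :
    tension h (conformal h ρ hρ) (id : N → N) x = (2 - n : ℝ) • grad h ρ x := by
  rw [tension, localMetric_conformal]
  simp only [id]
  rw [trace_secondFundForm_conf (writtenInExtChartAt_id_eventuallyEq x)
    (isMetricAt_localMetric h x) (isGradAt_localGrad h hρ x), map_smul, ofCoord_localGrad]

/-- The tension field of the identity map from `e^{2ρ} h` to `h`. -/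
theorem tension_conformal' (h : RiemMetric n N) {ρ : N → ℝ} (hρ : ContMDiff (𝓡 n) 𝓘(ℝ, ℝ) ∞ ρ)
    (x : N) :
    tension (conformal h ρ hρ) h (id : N → N) x
      = (n - 2 : ℝ) • (Real.exp (-2 * ρ x) • grad h ρ x) := by
  rw [tension, localMetric_conformal]
  simp only [id]
  rw [trace_secondFundForm_conf' (writtenInExtChartAt_id_eventuallyEq x)
    (isMetricAt_localMetric h x) (isGradAt_localGrad h hρ x), map_smul, map_smul,
    ofCoord_localGrad, extChartAt_to_inv]

theorem bitension_id (g h : RiemMetric n N) (x : N) :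
    bitension g h (id : N → N) x
      = ofCoord x x (localBitension (localMetric g x) (localMetric h x)
        (localSection (id : N → N) (tension g h id) x) (extChartAt (𝓡 n) x x)) := by
  have hf := writtenInExtChartAt_id_eventuallyEq (n := n) x
  have h1 : covHessianAlong (localMetric g x) (localMetric h x)
      (writtenInExtChartAt (𝓡 n) (𝓡 n) x (id : N → N))
      (localSection (id : N → N) (tension g h id) x) (extChartAt (𝓡 n) x x)
      = covHessian (localMetric g x) (localMetric h x)
        (localSection (id : N → N) (tension g h id) x) (extChartAt (𝓡 n) x x) := by
    funext X Y
    exact covHessianAlong_eq hf Filter.EventuallyEq.rfl _ _ X Y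
  -- The two minus signs, in Δ and in -J, cancel on the Hessian trace; the curvature trace keeps
  -- one.
  rw [bitension, jacobi, laplacianAlong, curvatureTrace, hf.fderiv_eq, localBitension]
  simp only [id] at h1 ⊢
  rw [h1, map_sub]
  simp only [fderiv_id, ContinuousLinearMap.id_apply]
  abel

theorem bitension_conformal_add (h : RiemMetric n N) {ρ : N → ℝ}
    (hρ : ContMDiff (𝓡 n) 𝓘(ℝ, ℝ) ∞ ρ) (x : N) :
    (bitension (conformal h ρ hρ) h id x : TangentSpace (𝓡 n) x)
        + Real.exp (-4 * ρ x) • (bitension h (conformal h ρ hρ) id x : TangentSpace (𝓡 n) x)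
      = (Real.exp (-4 * ρ x) * ((n : ℝ) - 2) * ((n : ℝ) - 6)) •
          (grad h (gradNormSq h ρ) x - gradNormSq h ρ x • grad h ρ x) := by
  -- The tension at each point is computed in that point's own chart. Its intrinsic value as a
  -- multiple of the gradient lets it be read in the single chart at x and differentiated there.
  have h1 : localSection (id : N → N) (tension h (conformal h ρ hρ) id) x
      = fun w => (2 - n : ℝ) • localGrad h ρ x w := by
    funext w
    rw [localSection, localGrad, ← map_smul]
    exact congrArg _ (tension_conformal h hρ _)
  have h2 : localSection (id : N → N) (tension (conformal h ρ hρ) h id) x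
      = fun w => (n - 2 : ℝ) • (Real.exp (-2 * ρ ((extChartAt (𝓡 n) x).symm w))
        • localGrad h ρ x w) := by
    funext w
    rw [localSection, localGrad, ← map_smul, ← map_smul]
    exact congrArg _ (tension_conformal' h hρ _)
  have key := localBitension_add (isMetricAt_localMetric h x) (isGradAt_localGrad h hρ x)
    (localMetric_localGrad_gradNormSq h hρ x)
  have key' := congrArg (ofCoord x x) key
  rw [← gradNormSq_eq h hρ, extChartAt_to_inv] at key'
  simp only [map_add, map_smul, map_sub, ofCoord_localGrad] at key'
  rw [bitension_id, bitension_id, h1, h2, localMetric_conformal]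
  exact key'

end Charts

end RiemGeom

end

theorem mainTheorem6 {n : ℕ} {N : Type*} [TopologicalSpace N]
    [ChartedSpace (EuclideanSpace ℝ (Fin n)) N] [IsManifold (𝓡 n) ∞ N]
    (h : RiemGeom.RiemMetric n N) (ρ : N → ℝ) (hρ : ContMDiff (𝓡 n) 𝓘(ℝ, ℝ) ∞ ρ) :
    (∀ x : N,
      (RiemGeom.bitension (RiemGeom.conformal h ρ hρ) h id x : TangentSpace (𝓡 n) x)
          + Real.exp (-4 * ρ x) •
            (RiemGeom.bitension h (RiemGeom.conformal h ρ hρ) id x : TangentSpace (𝓡 n) x)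
        = (Real.exp (-4 * ρ x) * ((n : ℝ) - 2) * ((n : ℝ) - 6)) •
            (RiemGeom.grad h (RiemGeom.gradNormSq h ρ) x
              - RiemGeom.gradNormSq h ρ x • RiemGeom.grad h ρ x)) ∧
    ((n = 6 ∨ ∀ x : N, RiemGeom.grad h (RiemGeom.gradNormSq h ρ) x
        = RiemGeom.gradNormSq h ρ x • RiemGeom.grad h ρ x) →
      (RiemGeom.IsBiharmonic h (RiemGeom.conformal h ρ hρ) (id : N → N) ↔
        RiemGeom.IsBiharmonic (RiemGeom.conformal h ρ hρ) h (id : N → N))) := by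
  refine ⟨RiemGeom.bitension_conformal_add h hρ, fun hc => ?_⟩
  have hsum : ∀ x : N,
      (RiemGeom.bitension (RiemGeom.conformal h ρ hρ) h id x : TangentSpace (𝓡 n) x)
          + Real.exp (-4 * ρ x) •
            (RiemGeom.bitension h (RiemGeom.conformal h ρ hρ) id x : TangentSpace (𝓡 n) x)
        = 0 := by
    intro x
    rw [RiemGeom.bitension_conformal_add h hρ x]
    rcases hc with hn | hg
    · have hn' : (n : ℝ) - 6 = 0 := by
        rw [hn]
        norm_num
      rw [hn', mul_zero, zero_smul]
    · rw [hg x, sub_self, smul_zero]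
  -- Smoothness of the identity is common to both sides. Pointwise, the vanishing sum makes each
  -- bitension field a nonzero multiple of the other.
  refine and_congr_right fun _ => forall_congr' fun x => ⟨fun h0 => ?_, fun h0 => ?_⟩
  · have := hsum x
    erw [h0, smul_zero, add_zero] at this
    exact this
  · have := hsum x
    erw [h0, zero_add] at this
    exact (smul_eq_zero.1 this).resolve_left (Real.exp_pos _).ne'
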